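/- For a positive even integer $d$ and real $x$ let $$\pi_d(x)=\left|\{p\le x:\ p\text{ and }p+d\text{ are both prime}\}\right|.$$ Let $h=h(x)$ be a real-valued function of the real variable $x$, positive for all sufficiently large $x$, such that, as $x\to\infty$, $$h=o\!\left(\frac{x}{\log^2x}\right)\qquad\text{and}\qquad \log x=o(h).$$ Let $m=m(x)$ be an integer-valued function, positive for all sufficiently large $x$, such that $m=o(h/\log x)$ as $x\to\infty$, and put $M=M(x)=\lfloor h/(2m)\rfloor$. Then $$\frac1{M^2}\sum_{1\le k\le M}2(M-k)\,\pi_{2mk}(x)\ \ge\ \frac{x}{\log^2x}\,(1+o(1)),$$ that is, for every $\varepsilon>0$ there is $x_\varepsilon$ such that for all $x\ge x_\varepsilon$ the left-hand side is at least $(1-\varepsilon)\,x/\log^2x$. -/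

import Mathlib

open Filter Asymptotics

/-- The prime pair counting function `π_d(x)`: the number of primes `p ≤ x` such that `p + d`
is also a prime. -/
noncomputable def primePairCount (d : ℕ) (x : ℝ) : ℕ :=
  Set.ncard {p : ℕ | (p : ℝ) ≤ x ∧ p.Prime ∧ (p + d).Prime}

/-- The set counted by `primePairCount` is finite, so its `ncard` is its cardinality. -/
theorem primePairCount_set_finite (d : ℕ) (x : ℝ) :
    {p : ℕ | (p : ℝ) ≤ x ∧ p.Prime ∧ (p + d).Prime}.Finite :=
  (Set.finite_Iic ⌊x⌋₊).subset fun _ hp => Nat.le_floor hp.1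

/-- `f(x) ≥ g(x)(1 + o(1))` as `x → ∞`: for every `ε > 0`, `f(x) ≥ (1 - ε) g(x)` for all
sufficiently large `x`. -/
def AsympGE (f g : ℝ → ℝ) : Prop :=
  ∀ ε : ℝ, 0 < ε → ∃ x₀ : ℝ, ∀ x : ℝ, x₀ ≤ x → (1 - ε) * g x ≤ f x

/-! Let `A` be the set of `u` with `2u+1` a prime at most `x`. The `M` translates `A + mj` lie in an
interval of length `W ~ x/2`. Cauchy–Schwarz on the representation counts
(`sq_card_mul_le_sum_pairCount`) bounds `(M|A|)²/W` by the diagonal `M|A|` plus the weighted sum of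
pair counts; the diagonal is negligible because `M/log x → ∞`. Halving the odd primes gains a factor
2, so the prime number theorem is not needed: `π(x) ≥ c x/log x` with `2c² > 1` suffices, and `ε` is
never spent. Central binomials give only `c = log 2 < 1/√2`; the quotient `(6n)! n! / ((3n)!
(2n)!²)` gives any `c < log 108 / 6 ≈ 0.78`. -/

/-! ### Chebyshev's lower bound for the number of primes -/

open ArithmeticFunction in
/-- Legendre's formula in logarithmic form. -/
theorem log_factorial_eq_sum_vonMangoldt {n N : ℕ} (hn : n ≤ N) :
    Real.log (n.factorial : ℝ) = ∑ d ∈ Finset.Ioc 0 N, vonMangoldt d * ((n / d : ℕ) : ℝ) := by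
  have h1 : Real.log (n.factorial : ℝ) = ∑ k ∈ Finset.Ioc 0 n, Real.log (k : ℝ) := by
    clear hn
    induction n with
    | zero => simp
    | succ n ih =>
      rw [Nat.factorial_succ, Nat.cast_mul, Real.log_mul (by positivity) (by positivity), ih,
        Finset.sum_Ioc_succ_top (Nat.zero_le n), add_comm]
  have h2 := sum_Ioc_mul_zeta_eq_sum vonMangoldt n
  rw [vonMangoldt_mul_zeta] at h2
  simp only [log_apply] at h2
  rw [h1, h2]
  refine Finset.sum_subset (Finset.Ioc_subset_Ioc_right hn) fun d _ hd => ?_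
  have : n / d = 0 := by
    apply Nat.div_eq_of_lt
    simp only [Finset.mem_Ioc] at *
    omega
  simp [this]

theorem log_factorial_combination_le_psi (n : ℕ) :
    Real.log ((6 * n).factorial : ℝ) + Real.log (n.factorial : ℝ)
      ≤ Chebyshev.psi ((6 * n : ℕ) : ℝ) + Real.log ((3 * n).factorial : ℝ)
        + 2 * Real.log ((2 * n).factorial : ℝ) := by
  rw [log_factorial_eq_sum_vonMangoldt (le_refl (6 * n)),
    log_factorial_eq_sum_vonMangoldt (show n ≤ 6 * n by omega),
    log_factorial_eq_sum_vonMangoldt (show 3 * n ≤ 6 * n by omega),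
    log_factorial_eq_sum_vonMangoldt (show 2 * n ≤ 6 * n by omega), Chebyshev.psi,
    Nat.floor_natCast, Finset.mul_sum, ← Finset.sum_add_distrib, ← Finset.sum_add_distrib,
    ← Finset.sum_add_distrib]
  refine Finset.sum_le_sum fun d _ => ?_
  have h2 : 3 * n / d = 6 * n / d / 2 := by
    rw [Nat.div_div_eq_div_mul, mul_comm d 2, show 6 * n = 2 * (3 * n) by ring,
      Nat.mul_div_mul_left _ _ two_pos]
  have h3 : 2 * n / d = 6 * n / d / 3 := by
    rw [Nat.div_div_eq_div_mul, mul_comm d 3, show 6 * n = 3 * (2 * n) by ring,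
      Nat.mul_div_mul_left _ _ three_pos]
  have h6 : n / d = 6 * n / d / 6 := by
    rw [Nat.div_div_eq_div_mul, mul_comm d 6, Nat.mul_div_mul_left _ _ (by norm_num)]
  -- With `q = 6 * n / d`, this is `q + ⌊q/6⌋ ≤ 1 + ⌊q/2⌋ + 2⌊q/3⌋`, a check modulo 6.
  have key : 6 * n / d + n / d ≤ 1 + 3 * n / d + 2 * (2 * n / d) := by omega
  have key' : ((6 * n / d : ℕ) : ℝ) + ((n / d : ℕ) : ℝ)
      ≤ 1 + ((3 * n / d : ℕ) : ℝ) + 2 * ((2 * n / d : ℕ) : ℝ) := by exact_mod_cast key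
  have h0 : 0 ≤ ArithmeticFunction.vonMangoldt d := ArithmeticFunction.vonMangoldt_nonneg
  nlinarith [mul_le_mul_of_nonneg_left key' h0]

/-- The consecutive ratio of the factorial quotient tends to `6⁶ / (3³ · 2⁴) = 108`; the factor `4 *
n` absorbs the shortfall. -/
theorem pow_mul_factorial_le (n : ℕ) (hn : 1 ≤ n) :
    108 ^ n * ((3 * n).factorial * (2 * n).factorial ^ 2)
      ≤ 4 * n * ((6 * n).factorial * n.factorial) := by
  induction n, hn using Nat.le_induction with
  | base => decide
  | succ n hn ih =>
    have e6 : (6 * (n + 1)).factorial = (6 * n + 6) * (6 * n + 5) * (6 * n + 4) * (6 * n + 3)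
        * (6 * n + 2) * (6 * n + 1) * (6 * n).factorial := by
      rw [show 6 * (n + 1) = 6 * n + 5 + 1 by ring]
      simp only [Nat.factorial_succ]
      ring
    have e3 : (3 * (n + 1)).factorial = (3 * n + 3) * (3 * n + 2) * (3 * n + 1)
        * (3 * n).factorial := by
      rw [show 3 * (n + 1) = 3 * n + 2 + 1 by ring]
      simp only [Nat.factorial_succ]
      ring
    have e2 : (2 * (n + 1)).factorial = (2 * n + 2) * (2 * n + 1) * (2 * n).factorial := by
      rw [show 2 * (n + 1) = 2 * n + 1 + 1 by ring]
      simp only [Nat.factorial_succ]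
      ring
    rw [e6, e3, e2, Nat.factorial_succ]
    have hpoly : 108 * (2 * (n + 1) * (2 * n + 1)) * n ≤
        (n + 1) * (12 * ((6 * n + 1) * (6 * n + 5))) := by nlinarith
    set B := (3 * n + 3) * (3 * n + 2) * (3 * n + 1) * ((2 * n + 2) * (2 * n + 1)) with hB
    refine Nat.le_of_mul_le_mul_left ?_ (show 0 < n by omega)
    calc n * (108 ^ (n + 1) * ((3 * n + 3) * (3 * n + 2) * (3 * n + 1) * (3 * n).factorial
            * ((2 * n + 2) * (2 * n + 1) * (2 * n).factorial) ^ 2))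
        = (108 * (2 * (n + 1) * (2 * n + 1)) * n) * B
            * (108 ^ n * ((3 * n).factorial * (2 * n).factorial ^ 2)) := by rw [hB]; ring
      _ ≤ ((n + 1) * (12 * ((6 * n + 1) * (6 * n + 5)))) * B
            * (4 * n * ((6 * n).factorial * n.factorial)) := by gcongr
      _ = n * (4 * (n + 1) * ((6 * n + 6) * (6 * n + 5) * (6 * n + 4) * (6 * n + 3) * (6 * n + 2)
            * (6 * n + 1) * (6 * n).factorial * ((n + 1) * n.factorial))) := by rw [hB]; ring

theorem psi_six_mul_ge (n : ℕ) (hn : 1 ≤ n) :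
    n * Real.log 108 - Real.log (4 * n) ≤ Chebyshev.psi ((6 * n : ℕ) : ℝ) := by
  have h : (108 : ℝ) ^ n * (((3 * n).factorial : ℝ) * ((2 * n).factorial : ℝ) ^ 2)
      ≤ 4 * n * (((6 * n).factorial : ℝ) * (n.factorial : ℝ)) := by
    exact_mod_cast pow_mul_factorial_le n hn
  have hn' : (0 : ℝ) < n := by exact_mod_cast hn
  have hl := Real.log_le_log (by positivity) h
  rw [Real.log_mul (by positivity) (by positivity), Real.log_mul (by positivity) (by positivity),
    Real.log_mul (x := 4 * n) (by positivity) (by positivity),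
    Real.log_mul (x := ((6 * n).factorial : ℝ)) (by positivity) (by positivity),
    Real.log_pow, Real.log_pow] at hl
  push_cast at hl
  linarith [log_factorial_combination_le_psi n]

theorem log_108_ge : (4.6 : ℝ) ≤ Real.log 108 := by
  rw [Real.le_log_iff_exp_le (by norm_num)]
  have h : Real.exp 4.6 ^ 5 ≤ 108 ^ 5 := by
    rw [← Real.exp_nat_mul, show ((5 : ℕ) : ℝ) * 4.6 = ((23 : ℕ) : ℝ) * 1 by norm_num,
      Real.exp_nat_mul]
    calc Real.exp 1 ^ 23 ≤ (2.7182818286 : ℝ) ^ 23 := by gcongr; exact Real.exp_one_lt_d9.le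
      _ ≤ 108 ^ 5 := by norm_num
  exact le_of_pow_le_pow_left₀ (by norm_num) (by norm_num) h

theorem eventually_le_primeCounting_mul_log :
    ∀ᶠ x : ℝ in atTop, 0.75 * x ≤ (Nat.primeCounting ⌊x⌋₊ : ℝ) * Real.log x := by
  have hlog : ∀ᶠ x : ℝ in atTop, Real.log x ≤ 0.001 * x := by
    filter_upwards [Real.isLittleO_log_id_atTop.bound (show (0 : ℝ) < 0.001 by norm_num),
      eventually_ge_atTop 1] with x hx h1
    simpa [abs_of_nonneg (Real.log_nonneg h1), abs_of_nonneg (zero_le_one.trans h1)] using hx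
  filter_upwards [hlog, eventually_ge_atTop 1000] with x hx h1
  have hx0 : 0 ≤ x := by linarith
  obtain ⟨n, hn⟩ : ∃ n : ℕ, n = ⌊x / 6⌋₊ := ⟨_, rfl⟩
  have hn1 : (n : ℝ) ≤ x / 6 := hn ▸ Nat.floor_le (by positivity)
  have hn2 : x / 6 - 1 < n := hn ▸ Nat.sub_one_lt_floor _
  have hpos : 1 ≤ n := by
    have : (0 : ℝ) < n := by linarith
    exact_mod_cast this
  have h2 := psi_six_mul_ge n hpos
  have h3 : Real.log (4 * n) ≤ Real.log x :=
    Real.log_le_log (by positivity) (by linarith)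
  have h4 : Chebyshev.psi ((6 * n : ℕ) : ℝ) ≤ Chebyshev.psi x :=
    Chebyshev.psi_mono (by push_cast; linarith)
  have h5 := Chebyshev.psi_le_primeCounting_mul_log' x
  have h6 : (n : ℝ) * 4.6 ≤ n * Real.log 108 := by gcongr; exact log_108_ge
  linarith

/-! ### Counting pairs with differences in an arithmetic progression -/

/-- The number of `a ∈ A` such that `a + d ∈ A`. -/
def pairCount (A : Finset ℕ) (d : ℕ) : ℕ := (A.filter fun a => a + d ∈ A).card

theorem pairCount_zero (A : Finset ℕ) : pairCount A 0 = A.card := by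
  simp [pairCount, Finset.filter_true_of_mem]

/-- Each distance `k ≥ 1` occurs for `2(M - k)` ordered pairs; the term `k = M` vanishes. -/
theorem sum_sum_dist_eq (C : ℕ → ℝ) (M : ℕ) :
    ∑ i ∈ Finset.range M, ∑ j ∈ Finset.range M, C (Nat.dist i j)
      = M * C 0 + ∑ k ∈ Finset.Icc 1 M, 2 * ((M : ℝ) - k) * C k := by
  induction M with
  | zero => simp
  | succ M ih =>
    have hr : ∑ i ∈ Finset.range M, C (Nat.dist i M) = ∑ k ∈ Finset.Icc 1 M, C k := by
      rw [← Finset.sum_range_reflect, Finset.range_eq_Ico, Finset.sum_Ico_eq_sum_range]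
      rw [← Finset.Ico_add_one_right_eq_Icc, Finset.sum_Ico_eq_sum_range]
      refine Finset.sum_congr (by simp) fun i hi => ?_
      simp only [Finset.mem_range] at hi
      congr 1
      rw [Nat.dist]
      omega
    have hr' : ∑ j ∈ Finset.range M, C (Nat.dist M j) = ∑ k ∈ Finset.Icc 1 M, C k := by
      simp only [Nat.dist_comm M, hr]
    simp only [Finset.sum_range_succ, Finset.sum_add_distrib]
    rw [ih, hr, hr', Nat.dist_self, Finset.sum_Icc_succ_top (by omega)]
    have : ∑ k ∈ Finset.Icc 1 M, 2 * (((M + 1 : ℕ) : ℝ) - k) * C k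
        = ∑ k ∈ Finset.Icc 1 M, 2 * ((M : ℝ) - k) * C k + 2 * ∑ k ∈ Finset.Icc 1 M, C k := by
      rw [Finset.mul_sum, ← Finset.sum_add_distrib]
      refine Finset.sum_congr rfl fun k _ => ?_
      push_cast
      ring
    rw [this]
    push_cast
    ring

theorem card_translates_inter_le (A T : Finset ℕ) (m i j : ℕ) :
    (T.filter fun t => (∃ a ∈ A, t = a + m * i) ∧ ∃ a ∈ A, t = a + m * j).card
      ≤ pairCount A (m * Nat.dist i j) := by
  wlog hij : i ≤ j generalizing i j
  · rw [Nat.dist_comm]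
    refine le_trans (le_of_eq ?_) (this j i (by omega))
    congr 1
    ext t
    simp only [Finset.mem_filter]
    tauto
  rw [Nat.dist_eq_sub_of_le hij]
  refine Finset.card_le_card_of_injOn (fun t => t - m * j) ?_ ?_
  · intro t ht
    simp only [Finset.coe_filter, Set.mem_ofPred_eq] at ht ⊢
    obtain ⟨-, ⟨a, ha, rfl⟩, b, hb, hab⟩ := ht
    have e : m * i + m * (j - i) = m * j := by rw [← mul_add, Nat.add_sub_cancel' hij]
    rw [hab, Nat.add_sub_cancel]
    exact ⟨hb, by rwa [show b + m * (j - i) = a by omega]⟩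
  · intro t ht s hs hts
    simp only [Finset.coe_filter, Set.mem_ofPred_eq] at ht hs
    obtain ⟨-, -, b, hb, rfl⟩ := ht
    obtain ⟨-, -, c, hc, rfl⟩ := hs
    simp only [Nat.add_sub_cancel] at hts
    rw [hts]

/-- Cauchy–Schwarz for the number of representations `a + m * j` with `a ∈ A` and `j < M`. -/
theorem sq_card_mul_le_sum_pairCount (A : Finset ℕ) (K m M : ℕ) (hA : A ⊆ Finset.range K) :
    ((M : ℝ) * A.card) ^ 2 ≤ ((K : ℝ) + m * M) * (M * A.card
      + ∑ k ∈ Finset.Icc 1 M, 2 * ((M : ℝ) - k) * (pairCount A (m * k) : ℝ)) := by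
  classical
  set T := Finset.range (K + m * M) with hT
  let P : ℕ → ℕ → Prop := fun j t => ∃ a ∈ A, t = a + m * j
  let g : ℕ → ℕ → ℝ := fun j t => if P j t then 1 else 0
  have hg : ∀ j ∈ Finset.range M, ∑ t ∈ T, g j t = A.card := by
    intro j hj
    simp only [g]
    rw [Finset.sum_boole]
    congr 1
    rw [← Finset.card_image_of_injective A (add_left_injective (m * j))]
    congr 1
    ext t
    simp only [Finset.mem_filter, Finset.mem_image, P, hT, Finset.mem_range] at hj ⊢
    constructor
    · rintro ⟨-, a, ha, rfl⟩
      exact ⟨a, ha, rfl⟩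
    · rintro ⟨a, ha, rfl⟩
      have := Finset.mem_range.1 (hA ha)
      have := Nat.mul_le_mul_left m hj.le
      exact ⟨by omega, a, ha, rfl⟩
  have hsum : ∑ t ∈ T, ∑ j ∈ Finset.range M, g j t = M * A.card := by
    rw [Finset.sum_comm, Finset.sum_congr rfl hg]
    simp
  have hsq : ∑ t ∈ T, (∑ j ∈ Finset.range M, g j t) ^ 2
      ≤ ∑ i ∈ Finset.range M, ∑ j ∈ Finset.range M, (pairCount A (m * Nat.dist i j) : ℝ) := by
    simp only [sq, Finset.sum_mul_sum]
    rw [Finset.sum_comm]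
    refine Finset.sum_le_sum fun i _ => ?_
    rw [Finset.sum_comm]
    refine Finset.sum_le_sum fun j _ => ?_
    simp only [g, ← ite_and, mul_ite, mul_one, mul_zero]
    rw [Finset.sum_boole]
    refine Nat.cast_le.2 (le_trans (le_of_eq ?_) (card_translates_inter_le A T m i j))
    congr 1
    ext t
    simp only [Finset.mem_filter, P]
    tauto
  rw [sum_sum_dist_eq fun k => (pairCount A (m * k) : ℝ), mul_zero, pairCount_zero] at hsq
  have hcs := sq_sum_le_card_mul_sum_sq (s := T) (f := fun t => ∑ j ∈ Finset.range M, g j t)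
  rw [hsum] at hcs
  refine hcs.trans ?_
  rw [hT, Finset.card_range]
  push_cast
  gcongr

/-! ### Odd primes -/

/-- The numbers `u` such that `2 * u + 1` is a prime not exceeding `N`. -/
def oddPrimeHalves (N : ℕ) : Finset ℕ :=
  (Finset.range ((N + 1) / 2)).filter fun u => (2 * u + 1).Prime

theorem primeCounting_le_card_oddPrimeHalves (N : ℕ) :
    Nat.primeCounting N ≤ (oddPrimeHalves N).card + 1 := by
  rw [← Nat.primesLE_card_eq_primeCounting]
  have hsub : Nat.primesLE N ⊆ insert 2 ((oddPrimeHalves N).image fun u => 2 * u + 1) := by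
    intro p hp
    rw [Nat.mem_primesLE] at hp
    rw [Finset.mem_insert, Finset.mem_image]
    refine hp.2.eq_two_or_odd'.imp_right ?_
    rintro ⟨u, rfl⟩
    refine ⟨u, ?_, rfl⟩
    simp only [oddPrimeHalves, Finset.mem_filter, Finset.mem_range]
    exact ⟨by omega, hp.2⟩
  calc _ ≤ _ := Finset.card_le_card hsub
    _ ≤ _ := Finset.card_insert_le _ _
    _ ≤ _ := Nat.add_le_add_right Finset.card_image_le 1

theorem pairCount_oddPrimeHalves_le (x : ℝ) (hx : 0 ≤ x) (d : ℕ) :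
    pairCount (oddPrimeHalves ⌊x⌋₊) d ≤ primePairCount (2 * d) x := by
  rw [pairCount, primePairCount, ← Set.ncard_coe_finset]
  refine Set.ncard_le_ncard_of_injOn (fun u => 2 * u + 1) ?_ ?_ (primePairCount_set_finite _ x)
  · intro u hu
    simp only [oddPrimeHalves, Finset.coe_filter, Finset.mem_filter, Finset.mem_range,
      Set.mem_ofPred_eq] at hu ⊢
    obtain ⟨⟨hu1, hu2⟩, -, hu3⟩ := hu
    refine ⟨(Nat.le_floor_iff hx).1 (by omega), hu2, ?_⟩
    rwa [show 2 * u + 1 + 2 * d = 2 * (u + d) + 1 by ring]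
  · intro a _ b _ hab
    simp only at hab
    omega

theorem sq_card_mul_le_sum_primePairCount (x : ℝ) (hx : 0 ≤ x) (m M : ℕ) :
    ((M : ℝ) * (oddPrimeHalves ⌊x⌋₊).card) ^ 2 ≤ ((x + 1) / 2 + m * M) *
      (M * (oddPrimeHalves ⌊x⌋₊).card
        + ∑ k ∈ Finset.Icc 1 M, 2 * ((M : ℝ) - k) * (primePairCount (2 * m * k) x : ℝ)) := by
  refine (sq_card_mul_le_sum_pairCount _ ((⌊x⌋₊ + 1) / 2) m M (Finset.filter_subset _ _)).trans ?_
  have hK : (((⌊x⌋₊ + 1) / 2 : ℕ) : ℝ) ≤ (x + 1) / 2 := by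
    refine Nat.cast_div_le.trans ?_
    push_cast
    linarith [Nat.floor_le hx]
  have hnn : ∀ k ∈ Finset.Icc 1 M, 0 ≤ 2 * ((M : ℝ) - k) := fun k hk => by
    have : (k : ℝ) ≤ M := by exact_mod_cast (Finset.mem_Icc.1 hk).2
    linarith
  refine mul_le_mul (by linarith) (add_le_add le_rfl (Finset.sum_le_sum fun k hk => ?_)) ?_
    (by positivity)
  · refine mul_le_mul_of_nonneg_left ?_ (hnn k hk)
    rw [mul_assoc]
    exact_mod_cast pairCount_oddPrimeHalves_le x hx (m * k)
  · exact add_nonneg (by positivity)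
      (Finset.sum_nonneg fun k hk => mul_nonneg (hnn k hk) (Nat.cast_nonneg _))

/-! ### The main theorem -/

/-- The margins close since `2 · 0.74 / 1.01 > 1.46`, the diagonal costs at most `0.01 M`, and `1.4
· 0.74 > 1`. -/
theorem le_of_sq_le_mul_add {x L A M S W : ℝ} (hx : 0 < x) (hL : 0 < L) (hM : 100 * L ≤ M)
    (hA : 0.74 * x ≤ A * L) (hW : 0 < W) (hWx : 2 * W ≤ 1.01 * x)
    (hS : (M * A) ^ 2 ≤ W * (M * A + S)) :
    x / L ^ 2 ≤ 1 / M ^ 2 * S := by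
  have hM0 : 0 < M := by linarith
  have hA0 : 0 < A := by
    by_contra! h
    nlinarith
  have h1 : (M * A) ^ 2 / W - M * A ≤ S := by
    rw [sub_le_iff_le_add, div_le_iff₀ hW]
    linarith
  have h2 : 1.4 * M ≤ M * A * L / W - L := by
    have : 1.46 * M ≤ M * A * L / W := by
      rw [le_div_iff₀ hW]
      nlinarith
    linarith
  have h3 : M * A * (1.4 * M) ≤ S * L := by
    calc M * A * (1.4 * M) ≤ M * A * (M * A * L / W - L) := by gcongr
      _ = ((M * A) ^ 2 / W - M * A) * L := by ring
      _ ≤ S * L := by gcongr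
  rw [div_le_iff₀ (by positivity), one_div, mul_assoc, ← div_eq_inv_mul,
    le_div_iff₀ (by positivity)]
  calc x * M ^ 2 ≤ 1.4 * M ^ 2 * (A * L) := by nlinarith [sq_nonneg M]
    _ = M * A * (1.4 * M) * L := by ring
    _ ≤ S * L * L := by gcongr
    _ = S * L ^ 2 := by ring

theorem mainTheorem6 (h : ℝ → ℝ) (m : ℝ → ℕ) (M : ℝ → ℕ)
    (hpos : ∀ᶠ x in atTop, 0 < h x)
    (hupper : h =o[atTop] fun x => x / Real.log x ^ 2)
    (hlower : Real.log =o[atTop] h)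
    (mpos : ∀ᶠ x in atTop, 0 < m x)
    (msmall : (fun x => (m x : ℝ)) =o[atTop] fun x => h x / Real.log x)
    (hM : ∀ x, M x = ⌊h x / (2 * (m x : ℝ))⌋₊) :
    AsympGE
      (fun x => 1 / (M x : ℝ) ^ 2 *
        ∑ k ∈ Finset.Icc 1 (M x),
          2 * ((M x : ℝ) - (k : ℝ)) * (primePairCount (2 * m x * k) x : ℝ))
      (fun x => x / Real.log x ^ 2) := by
  have hlog : ∀ᶠ x : ℝ in atTop, Real.log x ≤ 0.001 * x := by
    filter_upwards [Real.isLittleO_log_id_atTop.bound (show (0 : ℝ) < 0.001 by norm_num),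
      eventually_ge_atTop 1] with x hx h1
    simpa [abs_of_nonneg (Real.log_nonneg h1), abs_of_nonneg (zero_le_one.trans h1)] using hx
  have hev : ∀ᶠ x : ℝ in atTop, x / Real.log x ^ 2 ≤ 1 / (M x : ℝ) ^ 2 *
      ∑ k ∈ Finset.Icc 1 (M x),
        2 * ((M x : ℝ) - (k : ℝ)) * (primePairCount (2 * m x * k) x : ℝ) := by
    filter_upwards [hpos, mpos, hupper.bound (show (0 : ℝ) < 0.001 by norm_num),
      msmall.bound (show (0 : ℝ) < 1 / 400 by norm_num), hlog,
      eventually_le_primeCounting_mul_log, eventually_ge_atTop 1000,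
      Real.tendsto_log_atTop.eventually_ge_atTop 1] with x hh hm hu hs hl hπ hx hL
    have hx0 : 0 < x := by linarith
    have hL0 : 0 < Real.log x := by linarith
    have hm0 : (0 : ℝ) < m x := by exact_mod_cast hm
    rw [Real.norm_of_nonneg hh.le, Real.norm_of_nonneg (by positivity)] at hu
    rw [Real.norm_of_nonneg hm0.le, Real.norm_of_nonneg (by positivity)] at hs
    have hhx : h x ≤ 0.001 * x := by
      refine hu.trans ?_
      gcongr
      exact div_le_self hx0.le (one_le_pow₀ hL)
    have hMle : (M x : ℝ) ≤ h x / (2 * m x) := hM x ▸ Nat.floor_le (by positivity)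
    have hMgt : h x / (2 * m x) - 1 < M x := hM x ▸ Nat.sub_one_lt_floor _
    have hmM : (m x : ℝ) * M x ≤ h x / 2 := by
      rw [le_div_iff₀ (by positivity)] at hMle
      linarith
    have hM100 : 100 * Real.log x ≤ M x := by
      -- The floor loses at most `1 ≤ log x`, so 200 leaves ample room for 100.
      have : 200 * Real.log x ≤ h x / (2 * m x) := by
        rw [le_div_iff₀ (by positivity)]
        rw [← mul_div_assoc, le_div_iff₀ hL0] at hs
        linarith
      linarith
    have hcard : (Nat.primeCounting ⌊x⌋₊ : ℝ) ≤ (oddPrimeHalves ⌊x⌋₊).card + 1 := by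
      exact_mod_cast primeCounting_le_card_oddPrimeHalves ⌊x⌋₊
    refine le_of_sq_le_mul_add hx0 hL0 hM100 ?_ (by positivity) ?_
      (sq_card_mul_le_sum_primePairCount x hx0.le (m x) (M x))
    · nlinarith
    · linarith
  intro ε hε
  obtain ⟨x₀, hx₀⟩ := eventually_atTop.1 hev
  -- `x ≥ 0` makes the main term nonnegative, so the factor `1 - ε` only weakens the bound.
  refine ⟨max x₀ 0, fun x hx => le_trans ?_ (hx₀ x (le_of_max_le_left hx))⟩
  have : 0 ≤ x / Real.log x ^ 2 := div_nonneg (le_of_max_le_right hx) (sq_nonneg _)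
  nlinarith
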